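/- **Lemma (sufficient condition for local stability and convergence).** Consider a power network given by a connected undirected graph with buses $\{1,\dots,n\}$ and $m\ge 1$ transmission lines $e_1,\dots,e_m$, with oriented incidence matrix $D\in\mathbb{R}^{m\times n}$ ($d_{ki}=1$ if $i$ is the positive end of $e_k$, $-1$ if $i$ is its negative end, $0$ otherwise), a diagonal matrix $Y_b\in\mathbb{R}^{m\times m}$ of line susceptances $[Y_b]_{kk}>0$, inertia coefficients $M_i>0$, damping coefficients $E_i>0$, power injections $p\in\mathbb{R}^n$, and a set $\mathfrak{C}\subseteq\{1,\dots,n\}$ of controlled buses. For functions $u_i:\mathbb{R}^{m+n}\times\mathbb{R}^n\to\mathbb{R}$, $i\in\mathfrak{C}$, and $x=(\lambda,\omega)\in\mathbb{R}^m\times\mathbb{R}^n$, the closed-loop system is $$\dot\lambda=D\omega,\qquad M_i\dot\omega_i=-E_i\omega_i-[D^TY_b\sin\lambda]_i+p_i+\begin{cases}u_i(x,p)& i\in\mathfrak{C},\\ 0& i\notin\mathfrak{C},\end{cases}$$ where $\sin$ acts componentwise. Put $\omega^\infty=\sum_i p_i/\sum_i E_i$, $\tilde p_i=p_i-\omega^\infty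 E_i$, $\Gamma=\{\lambda\in\mathbb{R}^m: |\lambda_k|<\pi/2\ \forall k\}$ and $\Gamma_{\mathrm{cl}}=\{\lambda\in\mathbb{R}^m: |\lambda_k|\le\pi/2\ \forall k\}$. Suppose that $\lambda^\infty\in\Gamma\cap\operatorname{range}(D)$ satisfies $\tilde p=D^TY_b\sin\lambda^\infty$. Let $$V(\lambda,\omega)=\tfrac12\sum_{i=1}^n M_i(\omega_i-\omega^\infty)^2+\sum_{k=1}^m [Y_b]_{kk}\bigl(\cos\lambda_k^\infty-\cos\lambda_k-\lambda_k\sin\lambda_k^\infty+\lambda_k^\infty\sin\lambda_k^\infty\bigr),$$ let $c=\min_{\lambda\in\partial\Gamma_{\mathrm{cl}}}V(\lambda,\omega^\infty\mathbf 1)$, and for $\beta>0$ let $\Phi_\beta=\{(\lambda,\omega):\lambda\in\Gamma_{\mathrm{cl}},\ V(\lambda,\omega)\le c/\beta\}$. Suppose that for every $i\in\mathfrak{C}$ the function $x\mapsto u_i(x,p)$ is Lipschitz near every point of $\mathbb{R}^{m+n}$, and that for every $x=(\lambda,\omega)$ $$(\omega_i-\omega^\infty)\,u_i(x,p)\le 0\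 \text{ if }\omega_i\ne\omega^\infty,\qquad u_i(x,p)=0\ \text{ if }\omega_i=\omega^\infty .$$ Then $\lambda^\infty$ is the only $\lambda\in\Gamma_{\mathrm{cl}}\cap\operatorname{range}(D)$ with $\tilde p=D^TY_b\sin\lambda$, and: * $(\lambda^\infty,\omega^\infty\mathbf 1)$ is a (Lyapunov) stable equilibrium of the closed-loop system: for every neighbourhood $U$ of it there is a neighbourhood $W$ of it such that from every point of $W$ there is a solution on $[0,\infty)$, and every such solution stays in $U$; * for every $\beta>1$ and every initial state $(\lambda(0),\omega(0))\in\Phi_\beta$ with $\lambda(0)\in\operatorname{range}(D)$: 1. there is a solution on $[0,\infty)$, and every solution on an interval $[0,T)$ with the same initial state coincides with it on $[0,T)$; 2. $\lambda(t)\in\operatorname{range}(D)$ and $(\lambda(t),\omega(t))\in\Phi_\beta$ for all $t\ge 0$; 3. $(\lambda(t),\omega(t))\to(\lambda^\infty,\omega^\infty\mathbf 1)$ as $t\to\infty$. -/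

import Mathlib

open Set Filter Topology Matrix

/-- A power network with buses `Fin n` and transmission lines `Fin m`: a connected undirected
graph whose edges are enumerated (each exactly once) and oriented, line susceptances, inertia and
damping coefficients (all strictly positive), and the set of buses carrying a controller. -/
structure PowerNetwork (n m : ℕ) where
  graph : SimpleGraph (Fin n)
  connected : graph.Connected
  /-- positive end of each line -/
  pos : Fin m → Fin n
  /-- negative end of each line -/
  neg : Fin m → Fin n
  edge_bijOn : BijOn (fun k => s(pos k, neg k)) univ graph.edgeSet
  susceptance : Fin m → ℝ
  susceptance_pos : ∀ k, 0 < susceptance k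
  inertia : Fin n → ℝ
  inertia_pos : ∀ i, 0 < inertia i
  damping : Fin n → ℝ
  damping_pos : ∀ i, 0 < damping i
  controlled : Finset (Fin n)

/-- States `x = (λ, ω)`: angle differences along lines and bus frequencies. Only the topology and
the local Lipschitz structure of this space are used, so that the choice of norm is immaterial. -/
abbrev GridState (n m : ℕ) : Type := (Fin m → ℝ) × (Fin n → ℝ)

/-- Componentwise sine. -/
noncomputable def sinVec {m : ℕ} (l : Fin m → ℝ) : Fin m → ℝ := fun k => Real.sin (l k)

/-- `Γ = {λ : |λ_k| < π/2 for all k}`. -/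
def openBox (m : ℕ) : Set (Fin m → ℝ) := {l | ∀ k, |l k| < Real.pi / 2}

/-- `Γ_cl = {λ : |λ_k| ≤ π/2 for all k}`. -/
def closedBox (m : ℕ) : Set (Fin m → ℝ) := {l | ∀ k, |l k| ≤ Real.pi / 2}

namespace PowerNetwork

variable {n m : ℕ}

/-- The oriented incidence matrix `D`. -/
def incidence (N : PowerNetwork n m) : Matrix (Fin m) (Fin n) ℝ :=
  Matrix.of fun k i => if i = N.pos k then 1 else if i = N.neg k then -1 else 0

/-- The range (column space) of `D`. -/
def rangeD (N : PowerNetwork n m) : Set (Fin m → ℝ) :=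
  Set.range fun θ : Fin n → ℝ => N.incidence *ᵥ θ

/-- The diagonal matrix `Y_b` of line susceptances. -/
def Yb (N : PowerNetwork n m) : Matrix (Fin m) (Fin m) ℝ := Matrix.diagonal N.susceptance

/-- `Dᵀ Y_b sin λ`. -/
noncomputable def flow (N : PowerNetwork n m) (l : Fin m → ℝ) : Fin n → ℝ :=
  (N.incidenceᵀ * N.Yb) *ᵥ sinVec l

/-- `ω^∞ = (∑ p_i) / (∑ E_i)`. -/
noncomputable def omegaInf (N : PowerNetwork n m) (p : Fin n → ℝ) : ℝ :=
  (∑ i, p i) / ∑ i, N.damping i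

/-- `p̃ = p - ω^∞ E 1`. -/
noncomputable def pTilde (N : PowerNetwork n m) (p : Fin n → ℝ) : Fin n → ℝ :=
  fun i => p i - N.omegaInf p * N.damping i

/-- The vector `ω^∞ 1`. -/
noncomputable def omegaInfVec (N : PowerNetwork n m) (p : Fin n → ℝ) : Fin n → ℝ :=
  fun _ => N.omegaInf p

/-- The closed-loop vector field `F(λ, ω)`: with the state feedback `u_i(x, p)` at the controlled
buses, `λ' = D ω` and `ω_i' = (- E_i ω_i - [Dᵀ Y_b]_i sin λ + u_i(x, p) + p_i) / M_i`, where the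
term `u_i(x, p)` is absent at the other buses. -/
noncomputable def field (N : PowerNetwork n m) (p : Fin n → ℝ)
    (u : Fin n → GridState n m → (Fin n → ℝ) → ℝ) (x : GridState n m) : GridState n m :=
  (N.incidence *ᵥ x.2,
    fun i => (-(N.damping i * x.2 i) - N.flow x.1 i
      + (if i ∈ N.controlled then u i x p else 0) + p i) / N.inertia i)

/-- `a(s) = cos s^∞ - cos s - s sin s^∞ + s^∞ sin s^∞`. -/
noncomputable def lineEnergy (sInfty s : ℝ) : ℝ :=
  Real.cos sInfty - Real.cos s - s * Real.sin sInfty + sInfty * Real.sin sInfty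

/-- The energy function `V(λ, ω)` associated with `λ^∞ = lInf`. -/
noncomputable def energy (N : PowerNetwork n m) (p : Fin n → ℝ) (lInf : Fin m → ℝ)
    (x : GridState n m) : ℝ :=
  1 / 2 * ∑ i, N.inertia i * (x.2 i - N.omegaInf p) ^ 2
    + ∑ k, N.susceptance k * lineEnergy (lInf k) (x.1 k)

/-- `c = min {V(λ, ω^∞ 1) : λ ∈ ∂Γ_cl}`; for `m ≥ 1` the infimum is attained, see
`isLeast_energyLevel`. -/
noncomputable def energyLevel (N : PowerNetwork n m) (p : Fin n → ℝ) (lInf : Fin m → ℝ) : ℝ :=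
  sInf ((fun l => N.energy p lInf (l, N.omegaInfVec p)) '' frontier (closedBox m))

/-- `Φ = {(λ, ω) : λ ∈ Γ_cl, V(λ, ω) ≤ c / β}`. -/
def region (N : PowerNetwork n m) (p : Fin n → ℝ) (lInf : Fin m → ℝ) (β : ℝ) :
    Set (GridState n m) :=
  {x | x.1 ∈ closedBox m ∧ N.energy p lInf x ≤ N.energyLevel p lInf / β}

end PowerNetwork

/-- `x` is a (differentiable) solution of `x' = F(x)` on the time interval `J`. -/
def IsSolutionOn {n m : ℕ} (F : GridState n m → GridState n m) (x : ℝ → GridState n m)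
    (J : Set ℝ) : Prop :=
  ∀ t ∈ J, HasDerivWithinAt x (F (x t)) J t

/-- `xe` is a Lyapunov stable equilibrium of `x' = F(x)`: it is an equilibrium, and for every
neighbourhood `U` of `xe` there is a neighbourhood `W` of `xe` such that from every point of `W`
there is a solution for all `t ≥ 0` and every such solution stays in `U`. -/
def IsStableEquilibrium {n m : ℕ} (F : GridState n m → GridState n m)
    (xe : GridState n m) : Prop :=
  F xe = 0 ∧ ∀ U ∈ 𝓝 xe, ∃ W ∈ 𝓝 xe, ∀ x₀ ∈ W,
    (∃ x : ℝ → GridState n m, IsSolutionOn F x (Ici 0) ∧ x 0 = x₀) ∧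
    ∀ x : ℝ → GridState n m, IsSolutionOn F x (Ici 0) → x 0 = x₀ → ∀ t, 0 ≤ t → x t ∈ U

theorem closedBox_eq_pi (m : ℕ) :
    closedBox m = Set.univ.pi fun _ => Icc (-(Real.pi / 2)) (Real.pi / 2) := by
  ext l
  simp only [closedBox, abs_le, mem_setOf_eq, mem_univ_pi, mem_Icc]

/-- For `m ≥ 1` the number `c` is a genuine minimum. -/
theorem PowerNetwork.isLeast_energyLevel {n m : ℕ} (N : PowerNetwork n m) (hm : 1 ≤ m)
    (p : Fin n → ℝ) (lInf : Fin m → ℝ) :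
    IsLeast ((fun l => N.energy p lInf (l, N.omegaInfVec p)) '' frontier (closedBox m))
      (N.energyLevel p lInf) := by
  have hcomp : IsCompact (closedBox m) := by
    rw [closedBox_eq_pi]
    exact isCompact_univ_pi fun _ => isCompact_Icc
  have hfr : IsCompact (frontier (closedBox m)) :=
    hcomp.of_isClosed_subset isClosed_frontier hcomp.isClosed.frontier_subset
  have hne : (frontier (closedBox m)).Nonempty := by
    have : Nonempty (Fin m) := ⟨⟨0, hm⟩⟩
    rw [nonempty_frontier_iff]
    refine ⟨⟨0, fun k => by simp; positivity⟩, fun h => ?_⟩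
    have h1 : (fun _ => Real.pi) ∈ closedBox m := by rw [h]; trivial
    have h2 := h1 ⟨0, hm⟩
    rw [abs_of_pos Real.pi_pos] at h2
    linarith [Real.pi_pos]
  have hcont : Continuous fun l => N.energy p lInf (l, N.omegaInfVec p) := by
    unfold PowerNetwork.energy PowerNetwork.lineEnergy
    fun_prop
  exact (hfr.image hcont).isLeast_sInf (hne.image _)

/-! `V` is a Lyapunov function. Along the closed loop its derivative is `-∑ E_i (ω_i - ω^∞)² + ∑
(ω_i - ω^∞) u_i ≤ 0`, the second sum over controlled buses (`hasDerivWithinAt_energy_field`): the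
power exchanged between inertia and lines cancels. Since `sin` increases strictly on `[-π/2, π/2]`,
`V` is positive on the box away from the equilibrium (`energy_pos`), and the equilibrium angle is
unique in the box and the range of `D` (`eq_of_flow_eq`).

For `d < c` the set `V ≤ d` in the box is compact and its angles avoid the boundary of the box, so
solutions cannot leave it (`mem_sublevel_of_solution`). Trapping gives global existence, uniqueness
and stability.

For convergence, Barbalat's lemma is used twice in place of LaSalle's principle: `V` converges, so
the dissipation tends to 0 and `ω → ω^∞`; then `ω' → 0`. Every cluster point therefore solves the
flow equation, with angles in the closed invariant set `range D`, and must be the equilibrium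
(`tendsto_equilibrium`). -/

/-! ### Differential equations, Barbalat's lemma and trapping. -/

theorem LocallyLipschitz.pi {α ι : Type*} {β : ι → Type*} [Fintype ι] [PseudoEMetricSpace α]
    [∀ i, PseudoEMetricSpace (β i)] {f : α → ∀ i, β i}
    (hf : ∀ i, LocallyLipschitz fun x => f x i) : LocallyLipschitz f := by
  intro x
  choose K t ht h using fun i => hf i x
  refine ⟨Finset.univ.sup K, ⋂ i, t i, Filter.iInter_mem.2 ht, fun y hy z hz =>
    edist_pi_le_iff.2 fun i => ?_⟩
  refine (h i (mem_iInter.1 hy i) (mem_iInter.1 hz i)).trans ?_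
  gcongr
  exact Finset.le_sup (Finset.mem_univ i)

theorem eqOn_Icc_of_lipschitzOn {E : Type*} [NormedAddCommGroup E] [NormedSpace ℝ E]
    {G : E → E} {S : Set E} {K : NNReal} (hG : LipschitzOnWith K G S) {x y : ℝ → E} {T : ℝ}
    (hx : ∀ t ∈ Icc 0 T, HasDerivWithinAt x (G (x t)) (Icc 0 T) t)
    (hy : ∀ t ∈ Icc 0 T, HasDerivWithinAt y (G (y t)) (Icc 0 T) t)
    (hxS : ∀ t ∈ Icc 0 T, x t ∈ S) (hyS : ∀ t ∈ Icc 0 T, y t ∈ S) (h0 : x 0 = y 0) :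
    EqOn x y (Icc 0 T) := by
  have key : ∀ z : ℝ → E, (∀ t ∈ Icc 0 T, HasDerivWithinAt z (G (z t)) (Icc 0 T) t) →
      ∀ t ∈ Ico 0 T, HasDerivWithinAt z (G (z t)) (Ici t) t := fun z hz t ht =>
    (hz t ⟨ht.1, ht.2.le⟩).mono_of_mem_nhdsWithin
      (mem_of_superset (Icc_mem_nhdsGE ht.2) (Icc_subset_Icc_left ht.1))
  exact ODE_solution_unique_of_mem_Icc_right (v := fun _ => G) (s := fun _ => S)
    (fun _ _ => hG) (fun t ht => (hx t ht).continuousWithinAt) (key x hx)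
    (fun t ht => hxS t ⟨ht.1, ht.2.le⟩) (fun t ht => (hy t ht).continuousWithinAt) (key y hy)
    (fun t ht => hyS t ⟨ht.1, ht.2.le⟩) h0

/-- A field bounded by `L` moves a point by at most `L * n` in time `n`, so Picard–Lindelöf applies
on every `[0, n]`; uniqueness makes the pieces agree. -/
theorem exists_solution_Ici_of_lipschitz_of_bounded {E : Type*} [NormedAddCommGroup E]
    [NormedSpace ℝ E] [CompleteSpace E] {G : E → E} {K L : NNReal} (hG : LipschitzWith K G)
    (hL : ∀ x, ‖G x‖ ≤ L) (x₀ : E) :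
    ∃ x : ℝ → E, x 0 = x₀ ∧ ∀ t ∈ Ici (0 : ℝ), HasDerivWithinAt x (G (x t)) (Ici 0) t := by
  have hex : ∀ n : ℕ, ∃ α : ℝ → E, α 0 = x₀ ∧
      ∀ t ∈ Icc (0 : ℝ) n, HasDerivWithinAt α (G (α t)) (Icc 0 n) t := by
    intro n
    have hP : IsPicardLindelof (fun _ => G) (⟨0, le_rfl, n.cast_nonneg⟩ : Icc (0 : ℝ) n) x₀
        (L * n) 0 L K :=
      { lipschitzOnWith := fun _ _ => hG.lipschitzOnWith
        continuousOn := fun _ _ => continuousOn_const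
        norm_le := fun _ _ x _ => hL x
        mul_max_le := by simp }
    exact hP.exists_eq_forall_mem_Icc_hasDerivWithinAt₀
  choose α h0 hα using hex
  have hagree : ∀ a b : ℕ, a ≤ b → EqOn (α a) (α b) (Icc 0 a) := fun a b hab =>
    eqOn_Icc_of_lipschitzOn (hG.lipschitzOnWith (s := univ)) (hα a)
      (fun t ht => (hα b t ⟨ht.1, ht.2.trans (by exact_mod_cast hab)⟩).mono
        (Icc_subset_Icc_right (by exact_mod_cast hab)))
      (fun _ _ => trivial) (fun _ _ => trivial) ((h0 a).trans (h0 b).symm)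
  have heq : ∀ b : ℕ, ∀ t ∈ Icc (0 : ℝ) b, α ⌈t⌉₊ t = α b t := fun b t ht =>
    hagree _ _ (Nat.ceil_le.2 ht.2) ⟨ht.1, Nat.le_ceil t⟩
  refine ⟨fun t => α ⌈t⌉₊ t, by simp [h0], fun t ht => ?_⟩
  obtain ⟨b, hb⟩ := exists_nat_gt t
  have hmem : Icc (0 : ℝ) b ∈ 𝓝[Ici 0] t :=
    mem_nhdsWithin.2 ⟨Iio (b : ℝ), isOpen_Iio, hb, fun s hs => ⟨hs.2, hs.1.le⟩⟩
  have htb : t ∈ Icc (0 : ℝ) b := ⟨ht, hb.le⟩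
  have h1 := (hα b t htb).congr (f₁ := fun t => α ⌈t⌉₊ t) (heq b) (heq b t htb)
  rw [← heq b t htb] at h1
  exact h1.mono_of_mem_nhdsWithin hmem

/-- **Barbalat's lemma.** -/
theorem tendsto_deriv_zero_of_uniformContinuousOn {f f' : ℝ → ℝ} {a : ℝ}
    (hf : ∀ t ∈ Ici (0 : ℝ), HasDerivWithinAt f (f' t) (Ici 0) t)
    (hf' : UniformContinuousOn f' (Ici 0)) (ha : Tendsto f atTop (𝓝 a)) :
    Tendsto f' atTop (𝓝 0) := by
  rw [Metric.tendsto_atTop]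
  intro ε hε
  obtain ⟨δ, hδ, hu⟩ := Metric.uniformContinuousOn_iff.1 hf' (ε / 2) (by positivity)
  have hdiff : Tendsto (fun t => f (t + δ / 2) - f t) atTop (𝓝 0) := by
    have := (ha.comp (tendsto_atTop_add_const_right atTop (δ / 2) tendsto_id)).sub ha
    simpa using this
  obtain ⟨T, hT⟩ := Metric.tendsto_atTop.1 hdiff (ε / 2 * (δ / 2)) (by positivity)
  refine ⟨max T 0, fun t ht => ?_⟩
  have ht0 : 0 ≤ t := (le_max_right _ _).trans ht
  have htT : T ≤ t := (le_max_left _ _).trans ht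
  -- `f' ξ` is the mean slope over a step of fixed length, small because `f` converges; uniform
  -- continuity transfers this to `f' t`.
  obtain ⟨ξ, hξ, hslope⟩ := exists_hasDerivAt_eq_slope f f' (show t < t + δ / 2 by linarith)
    (fun s hs => (hf s (ht0.trans hs.1)).continuousWithinAt.mono
      (fun r hr => ht0.trans hr.1))
    (fun s hs => (hf s (ht0.trans hs.1.le)).hasDerivAt (Ici_mem_nhds (ht0.trans_lt hs.1)))
  have h1 : |f' t - f' ξ| < ε / 2 := hu t ht0 ξ (ht0.trans hξ.1.le) (by
    rw [Real.dist_eq, abs_sub_comm, abs_of_pos (by linarith [hξ.1])]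
    linarith [hξ.2])
  have h2 : |f' ξ| < ε / 2 := by
    have := hT t htT
    rw [Real.dist_eq, sub_zero] at this
    rw [hslope, abs_div, abs_of_pos (show 0 < t + δ / 2 - t by linarith), div_lt_iff₀ (by linarith)]
    simpa using this
  rw [Real.dist_eq, sub_zero]
  calc |f' t| = |(f' t - f' ξ) + f' ξ| := by ring_nf
    _ ≤ |f' t - f' ξ| + |f' ξ| := abs_add_le _ _
    _ < ε := by linarith

/-- A curve along which `V` does not increase while in the open set `O` cannot leave a closed
subset of `O` that contains, with each point, all points of `O` where `V` is not larger. -/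
theorem mem_of_nonincreasing_along {E : Type*} [TopologicalSpace E] {K O : Set E} {V V' : E → ℝ}
    (hK : IsClosed K) (hO : IsOpen O) (hKO : K ⊆ O) (hV' : ∀ x ∈ O, V' x ≤ 0)
    (hmem : ∀ x ∈ K, ∀ y ∈ O, V y ≤ V x → y ∈ K) {y : ℝ → E} {a b : ℝ}
    (hy : ContinuousOn y (Icc a b))
    (hVy : ∀ t ∈ Icc a b, y t ∈ O →
      HasDerivWithinAt (fun s => V (y s)) (V' (y t)) (Icc a b) t)
    (ha : y a ∈ K) : ∀ t ∈ Icc a b, y t ∈ K := by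
  -- Continuous induction: the times spent in `K` form a closed set, and each one before `b` is
  -- followed by a short interval in `O`, on which `V` decreases.
  refine IsClosed.Icc_subset_of_forall_exists_gt (s := {t | y t ∈ K}) ?_ ha ?_
  · rw [inter_comm]
    exact hy.preimage_isClosed_of_isClosed isClosed_Icc hK
  · rintro t ⟨htK, ht⟩ r hr
    have hnhds : y ⁻¹' O ∈ 𝓝[Icc a b] t :=
      (hy t ⟨ht.1, ht.2.le⟩).preimage_mem_nhdsWithin (hO.mem_nhds (hKO htK))
    have hge : y ⁻¹' O ∈ 𝓝[≥] t := nhdsWithin_le_iff.2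
      (mem_of_superset (Icc_mem_nhdsGE ht.2) (Icc_subset_Icc_left ht.1)) hnhds
    obtain ⟨v, hv, hsub⟩ := (mem_nhdsGE_iff_exists_Icc_subset).1 hge
    set w := min (min v r) b
    have htw : t < w := lt_min (lt_min hv hr) ht.2
    have hwO : ∀ s ∈ Icc t w, y s ∈ O := fun s hs =>
      hsub ⟨hs.1, hs.2.trans ((min_le_left _ _).trans (min_le_left _ _))⟩
    have hwI : Icc t w ⊆ Icc a b := Icc_subset_Icc ht.1 (min_le_right _ _)
    have hanti : AntitoneOn (fun s => V (y s)) (Icc t w) := by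
      refine antitoneOn_of_hasDerivWithinAt_nonpos (f' := fun s => V' (y s)) (convex_Icc _ _)
        (fun s hs => ((hVy s (hwI hs) (hwO s hs)).mono hwI).continuousWithinAt) ?_ ?_
      · exact fun s hs => (hVy s (hwI (interior_subset hs)) (hwO s (interior_subset hs))).mono
          (interior_subset.trans hwI)
      · exact fun s hs => hV' _ (hwO s (interior_subset hs))
    refine ⟨w, hmem _ htK _ (hwO w ⟨htw.le, le_rfl⟩)
      (hanti ⟨le_rfl, htw.le⟩ ⟨htw.le, le_rfl⟩ htw.le), htw,
      (min_le_left _ _).trans (min_le_right _ _)⟩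

/-! ### Truncation of the state space. -/

/-- Retraction onto the closed ball of radius `R` (for the sup norm). -/
noncomputable def clampState {n m : ℕ} (R : ℝ) (x : GridState n m) : GridState n m :=
  (fun k => max (-R) (min R (x.1 k)), fun i => max (-R) (min R (x.2 i)))

/-- Precomposing with this retraction makes a locally Lipschitz field globally Lipschitz and
bounded, without changing it on the ball. -/
theorem lipschitzWith_clampState {n m : ℕ} (R : ℝ) :
    LipschitzWith 1 (clampState (n := n) (m := m) R) := by
  have h1 : LipschitzWith 1 fun s : ℝ => max (-R) (min R s) :=
    (LipschitzWith.id.const_min R).const_max (-R)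
  have hpi : ∀ q : ℕ, LipschitzWith 1 fun (x : Fin q → ℝ) k => max (-R) (min R (x k)) := by
    intro q x y
    refine edist_pi_le_iff.2 fun k => (h1 (x k) (y k)).trans ?_
    gcongr
    exact edist_le_pi_edist x y k
  have h := ((hpi m).comp LipschitzWith.prod_fst).prodMk ((hpi n).comp LipschitzWith.prod_snd)
  rw [max_self, mul_one] at h
  exact h

theorem clampState_mem_closedBall {n m : ℕ} {R : ℝ} (hR : 0 ≤ R) (x : GridState n m) :
    clampState R x ∈ Metric.closedBall (0 : GridState n m) R := by
  have h : ∀ s : ℝ, ‖max (-R) (min R s)‖ ≤ R := fun s => by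
    rw [Real.norm_eq_abs, abs_le]
    exact ⟨le_max_left _ _, max_le (by linarith) (min_le_left _ _)⟩
  rw [mem_closedBall_zero_iff, Prod.norm_def]
  exact max_le ((pi_norm_le_iff_of_nonneg hR).2 fun _ => h _)
    ((pi_norm_le_iff_of_nonneg hR).2 fun _ => h _)

theorem clampState_eq_self {n m : ℕ} {R : ℝ} {x : GridState n m}
    (hx : x ∈ Metric.closedBall (0 : GridState n m) R) : clampState R x = x := by
  rw [mem_closedBall_zero_iff] at hx
  have h : ∀ s : ℝ, ‖s‖ ≤ R → max (-R) (min R s) = s := fun s hs => by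
    rw [Real.norm_eq_abs, abs_le] at hs
    rw [min_eq_right hs.2, max_eq_right hs.1]
  refine Prod.ext (funext fun k => h _ ?_) (funext fun i => h _ ?_)
  · exact (norm_le_pi_norm _ k).trans ((norm_fst_le x).trans hx)
  · exact (norm_le_pi_norm _ i).trans ((norm_snd_le x).trans hx)

/-! ### Line potentials and the angle box. -/

/-- The derivative `sin s - sin a` has the sign of `s - a`, and the value at `a` is 0. -/
theorem lineEnergy_pos {a s : ℝ} (ha : |a| < Real.pi / 2) (hs : |s| ≤ Real.pi / 2) (h : s ≠ a) :
    0 < PowerNetwork.lineEnergy a s := by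
  rw [abs_lt] at ha
  rw [abs_le] at hs
  have hd : ∀ r, HasDerivAt (PowerNetwork.lineEnergy a) (Real.sin r - Real.sin a) r := by
    intro r
    have := (((Real.hasDerivAt_cos r).const_sub (Real.cos a)).sub
      ((hasDerivAt_id r).mul_const (Real.sin a))).add_const (a * Real.sin a)
    exact this.congr_deriv (by ring)
  have h0 : PowerNetwork.lineEnergy a a = 0 := by
    simp [PowerNetwork.lineEnergy]
  have hc : Continuous (PowerNetwork.lineEnergy a) :=
    continuous_iff_continuousAt.2 fun r => (hd r).continuousAt
  rcases lt_or_gt_of_ne h with hlt | hgt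
  · have := strictAntiOn_of_deriv_neg (convex_Icc s a) hc.continuousOn (fun r hr => by
      rw [interior_Icc] at hr
      rw [(hd r).deriv, sub_neg]
      exact Real.strictMonoOn_sin ⟨by linarith [hr.1], by linarith [hr.2]⟩
        ⟨by linarith, by linarith⟩ hr.2)
    simpa [h0] using this ⟨le_rfl, hlt.le⟩ ⟨hlt.le, le_rfl⟩ hlt
  · have := strictMonoOn_of_deriv_pos (convex_Icc a s) hc.continuousOn (fun r hr => by
      rw [interior_Icc] at hr
      rw [(hd r).deriv, sub_pos]
      exact Real.strictMonoOn_sin ⟨by linarith, by linarith⟩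
        ⟨by linarith [hr.1], by linarith [hr.2]⟩ hr.1)
    simpa [h0] using this ⟨le_rfl, hgt.le⟩ ⟨hgt.le, le_rfl⟩ hgt

theorem lineEnergy_self (a : ℝ) : PowerNetwork.lineEnergy a a = 0 := by
  simp [PowerNetwork.lineEnergy]

theorem lineEnergy_nonneg {a s : ℝ} (ha : |a| < Real.pi / 2) (hs : |s| ≤ Real.pi / 2) :
    0 ≤ PowerNetwork.lineEnergy a s := by
  rcases eq_or_ne s a with rfl | h
  · exact (lineEnergy_self s).ge
  · exact (lineEnergy_pos ha hs h).le

theorem isClosed_closedBox (m : ℕ) : IsClosed (closedBox m) := by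
  rw [closedBox_eq_pi]
  exact isClosed_set_pi fun _ _ => isClosed_Icc

theorem openBox_subset_interior_closedBox (m : ℕ) : openBox m ⊆ interior (closedBox m) := by
  refine interior_maximal (fun l hl k => (hl k).le) ?_
  have : openBox m = ⋂ k, {l : Fin m → ℝ | |l k| < Real.pi / 2} := by
    ext l
    simp [openBox]
  rw [this]
  exact isOpen_iInter_of_finite fun k =>
    isOpen_lt (continuous_abs.comp (continuous_apply k)) continuous_const

/-! ### Incidence algebra, energy balance and regularity of the field. -/

namespace PowerNetwork

variable {n m : ℕ}

theorem pos_ne_neg (N : PowerNetwork n m) (k : Fin m) : N.pos k ≠ N.neg k := by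
  have h : s(N.pos k, N.neg k) ∈ N.graph.edgeSet := N.edge_bijOn.mapsTo (mem_univ k)
  exact N.graph.ne_of_adj h

theorem incidence_mulVec_apply (N : PowerNetwork n m) (θ : Fin n → ℝ) (k : Fin m) :
    (N.incidence *ᵥ θ) k = θ (N.pos k) - θ (N.neg k) := by
  have h : ∀ i, N.incidence k i * θ i
      = (if i = N.pos k then θ i else 0) - (if i = N.neg k then θ i else 0) := by
    intro i
    have hne := N.pos_ne_neg k
    simp only [incidence, Matrix.of_apply]
    split_ifs with h1 h2
    · exact absurd (h1.symm.trans h2) hne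
    all_goals ring
  simp [Matrix.mulVec, dotProduct, h, Finset.sum_sub_distrib]

theorem incidence_mulVec_const (N : PowerNetwork n m) (a : ℝ) :
    (N.incidence *ᵥ fun _ => a) = 0 := by
  ext k
  simp [incidence_mulVec_apply]

theorem sum_mul_flow (N : PowerNetwork n m) (l : Fin m → ℝ) (θ : Fin n → ℝ) :
    ∑ i, θ i * N.flow l i = ∑ k, N.susceptance k * Real.sin (l k) * (N.incidence *ᵥ θ) k := by
  have h : N.flow l = N.incidenceᵀ *ᵥ fun k => N.susceptance k * Real.sin (l k) := by
    rw [flow, ← Matrix.mulVec_mulVec]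
    congr 1
    ext k
    simp [Yb, Matrix.mulVec_diagonal, sinVec]
  have := Matrix.dotProduct_mulVec θ N.incidenceᵀ fun k => N.susceptance k * Real.sin (l k)
  rw [Matrix.vecMul_transpose, ← h] at this
  simpa [dotProduct, mul_comm] using this

/-- Pairing the flow difference with `θ - θ'`, where `l = D θ` and `l' = D θ'`, gives a vanishing
weighted sum of `(sin l_k - sin l'_k) (l_k - l'_k)`; strict monotonicity of `sin` makes each term
positive unless `l_k = l'_k`. -/
theorem eq_of_flow_eq (N : PowerNetwork n m) {l l' : Fin m → ℝ} (hl : l ∈ closedBox m)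
    (hl' : l' ∈ closedBox m) (hr : l ∈ N.rangeD) (hr' : l' ∈ N.rangeD)
    (h : N.flow l = N.flow l') : l = l' := by
  obtain ⟨θ, rfl⟩ := hr
  obtain ⟨θ', rfl⟩ := hr'
  set l := N.incidence *ᵥ θ with hlθ
  set l' := N.incidence *ᵥ θ' with hlθ'
  have hmem : ∀ {r : Fin m → ℝ}, r ∈ closedBox m → ∀ k,
      r k ∈ Icc (-(Real.pi / 2)) (Real.pi / 2) := fun hr k => abs_le.1 (hr k)
  have hsum : ∑ k, N.susceptance k * ((Real.sin (l k) - Real.sin (l' k)) * (l k - l' k)) = 0 := by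
    have e1 := N.sum_mul_flow l (θ - θ')
    have e2 := N.sum_mul_flow l' (θ - θ')
    rw [h, e2, Matrix.mulVec_sub, ← hlθ, ← hlθ', ← sub_eq_zero, ← Finset.sum_sub_distrib] at e1
    rw [← neg_eq_zero, ← e1, ← Finset.sum_neg_distrib]
    refine Finset.sum_congr rfl fun k _ => ?_
    rw [Pi.sub_apply]
    ring
  have hpos : ∀ k, l k ≠ l' k → 0 < (Real.sin (l k) - Real.sin (l' k)) * (l k - l' k) := by
    intro k hk
    rcases lt_or_gt_of_ne hk with hlt | hgt
    · exact mul_pos_of_neg_of_neg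
        (sub_neg.2 (Real.strictMonoOn_sin (hmem hl k) (hmem hl' k) hlt)) (sub_neg.2 hlt)
    · exact mul_pos
        (sub_pos.2 (Real.strictMonoOn_sin (hmem hl' k) (hmem hl k) hgt)) (sub_pos.2 hgt)
  have hnn : ∀ k ∈ Finset.univ,
      0 ≤ N.susceptance k * ((Real.sin (l k) - Real.sin (l' k)) * (l k - l' k)) := by
    intro k _
    refine mul_nonneg (N.susceptance_pos k).le ?_
    by_cases hk : l k = l' k
    · simp [hk]
    · exact (hpos k hk).le
  ext k
  by_contra hk
  have := (Finset.sum_eq_zero_iff_of_nonneg hnn).1 hsum k (Finset.mem_univ k)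
  exact (mul_pos (N.susceptance_pos k) (hpos k hk)).ne' this

/-- The derivative of the energy along the closed-loop vector field. -/
noncomputable def dissipation (N : PowerNetwork n m) (p : Fin n → ℝ)
    (u : Fin n → GridState n m → (Fin n → ℝ) → ℝ) (x : GridState n m) : ℝ :=
  ∑ i, (-(N.damping i * (x.2 i - N.omegaInf p) ^ 2)
    + if i ∈ N.controlled then (x.2 i - N.omegaInf p) * u i x p else 0)

theorem continuous_energy (N : PowerNetwork n m) (p : Fin n → ℝ) (lInf : Fin m → ℝ) :
    Continuous (N.energy p lInf) := by
  unfold energy lineEnergy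
  fun_prop

theorem hasDerivWithinAt_energy (N : PowerNetwork n m) (p : Fin n → ℝ) (lInf : Fin m → ℝ)
    {y : ℝ → GridState n m} {v : GridState n m} {s : Set ℝ} {t : ℝ}
    (hy : HasDerivWithinAt y v s t) :
    HasDerivWithinAt (fun r => N.energy p lInf (y r))
      (∑ i, (y t).2 i * (N.inertia i * v.2 i) - N.omegaInf p * ∑ i, N.inertia i * v.2 i
        + ∑ k, N.susceptance k * (Real.sin ((y t).1 k) - Real.sin (lInf k)) * v.1 k) s t := by
  have hω : ∀ i, HasDerivWithinAt (fun r => (y r).2 i) (v.2 i) s t :=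
    hasDerivWithinAt_pi.1 hy.snd
  have hl : ∀ k, HasDerivWithinAt (fun r => (y r).1 k) (v.1 k) s t :=
    hasDerivWithinAt_pi.1 hy.fst
  have h1 := (HasDerivWithinAt.fun_sum (u := Finset.univ) fun i _ =>
    (((hω i).sub_const (N.omegaInf p)).pow 2).const_mul (N.inertia i)).const_mul (1 / 2)
  have h2 := HasDerivWithinAt.fun_sum (u := Finset.univ) fun k _ =>
    ((((hl k).cos.const_sub (Real.cos (lInf k))).sub
      ((hl k).mul_const (Real.sin (lInf k)))).add_const
        (lInf k * Real.sin (lInf k))).const_mul (N.susceptance k)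
  refine (h1.add h2).congr_deriv ?_
  congr 1
  · rw [Finset.mul_sum, Finset.mul_sum, ← Finset.sum_sub_distrib]
    refine Finset.sum_congr rfl fun i _ => ?_
    norm_num
    ring
  · refine Finset.sum_congr rfl fun k _ => ?_
    ring

theorem hasDerivWithinAt_energy_field (N : PowerNetwork n m) {p : Fin n → ℝ} {lInf : Fin m → ℝ}
    (hlInf_eq : N.pTilde p = N.flow lInf) (u : Fin n → GridState n m → (Fin n → ℝ) → ℝ)
    {y : ℝ → GridState n m} {s : Set ℝ} {t : ℝ}
    (hy : HasDerivWithinAt y (N.field p u (y t)) s t) :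
    HasDerivWithinAt (fun r => N.energy p lInf (y r)) (N.dissipation p u (y t)) s t := by
  refine (N.hasDerivWithinAt_energy p lInf hy).congr_deriv ?_
  set x := y t
  have hM : ∀ i, N.inertia i * (N.field p u x).2 i
      = -(N.damping i * (x.2 i - N.omegaInf p)) + (N.flow lInf i - N.flow x.1 i)
        + if i ∈ N.controlled then u i x p else 0 := by
    intro i
    have hne := (N.inertia_pos i).ne'
    rw [← congrFun hlInf_eq i]
    simp only [field, pTilde]
    rw [mul_div_cancel₀ _ hne]
    ring
  -- `D` kills constants, so `D ω = D (ω - ω^∞ 1)`: the line power can be paired with the frequency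
  -- deviations and cancels against the kinetic part.
  have hfl := N.sum_mul_flow x.1 (x.2 - fun _ => N.omegaInf p)
  have hfl' := N.sum_mul_flow lInf (x.2 - fun _ => N.omegaInf p)
  rw [Matrix.mulVec_sub, incidence_mulVec_const, sub_zero] at hfl hfl'
  have hline : ∑ k, N.susceptance k * (Real.sin (x.1 k) - Real.sin (lInf k))
      * (N.field p u x).1 k
      = ∑ i, (x.2 i - N.omegaInf p) * N.flow x.1 i
        - ∑ i, (x.2 i - N.omegaInf p) * N.flow lInf i := by
    simp only [Pi.sub_apply] at hfl hfl'
    rw [hfl, hfl', ← Finset.sum_sub_distrib]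
    refine Finset.sum_congr rfl fun k _ => ?_
    simp only [field]
    ring
  rw [hline, Finset.mul_sum, ← Finset.sum_sub_distrib, ← Finset.sum_sub_distrib,
    ← Finset.sum_add_distrib, dissipation]
  refine Finset.sum_congr rfl fun i _ => ?_
  rw [hM]
  split_ifs <;> ring

theorem dissipation_term_nonpos (N : PowerNetwork n m) {p : Fin n → ℝ}
    {u : Fin n → GridState n m → (Fin n → ℝ) → ℝ}
    (hu_sign : ∀ i ∈ N.controlled, ∀ x : GridState n m,
      x.2 i ≠ N.omegaInf p → (x.2 i - N.omegaInf p) * u i x p ≤ 0)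
    (x : GridState n m) (i : Fin n) :
    (-(N.damping i * (x.2 i - N.omegaInf p) ^ 2)
      + if i ∈ N.controlled then (x.2 i - N.omegaInf p) * u i x p else 0)
      ≤ -(N.damping i * (x.2 i - N.omegaInf p) ^ 2) := by
  split_ifs with hi
  · by_cases h : x.2 i = N.omegaInf p
    · simp [h]
    · linarith [hu_sign i hi x h]
  · simp

theorem damping_mul_sq_le_neg_dissipation (N : PowerNetwork n m) {p : Fin n → ℝ}
    {u : Fin n → GridState n m → (Fin n → ℝ) → ℝ}
    (hu_sign : ∀ i ∈ N.controlled, ∀ x : GridState n m,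
      x.2 i ≠ N.omegaInf p → (x.2 i - N.omegaInf p) * u i x p ≤ 0)
    (x : GridState n m) (i : Fin n) :
    N.damping i * (x.2 i - N.omegaInf p) ^ 2 ≤ -N.dissipation p u x := by
  have h1 : N.dissipation p u x ≤ ∑ i, -(N.damping i * (x.2 i - N.omegaInf p) ^ 2) :=
    Finset.sum_le_sum fun i _ => N.dissipation_term_nonpos hu_sign x i
  rw [Finset.sum_neg_distrib] at h1
  have h2 := Finset.single_le_sum (f := fun i => N.damping i * (x.2 i - N.omegaInf p) ^ 2)
    (fun i _ => mul_nonneg (N.damping_pos i).le (sq_nonneg _)) (Finset.mem_univ i)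
  exact h2.trans (by linarith)

theorem dissipation_nonpos (N : PowerNetwork n m) {p : Fin n → ℝ}
    {u : Fin n → GridState n m → (Fin n → ℝ) → ℝ}
    (hu_sign : ∀ i ∈ N.controlled, ∀ x : GridState n m,
      x.2 i ≠ N.omegaInf p → (x.2 i - N.omegaInf p) * u i x p ≤ 0)
    (x : GridState n m) : N.dissipation p u x ≤ 0 :=
  Finset.sum_nonpos fun i _ => (N.dissipation_term_nonpos hu_sign x i).trans
    (neg_nonpos.2 (mul_nonneg (N.damping_pos i).le (sq_nonneg _)))

theorem continuous_dissipation (N : PowerNetwork n m) {p : Fin n → ℝ}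
    {u : Fin n → GridState n m → (Fin n → ℝ) → ℝ}
    (hu : ∀ i ∈ N.controlled, Continuous fun x => u i x p) : Continuous (N.dissipation p u) := by
  unfold dissipation
  refine continuous_finsetSum _ fun i _ => Continuous.add (by fun_prop) ?_
  split_ifs with hi
  · have := hu i hi
    fun_prop
  · exact continuous_const

theorem locallyLipschitz_field (N : PowerNetwork n m) {p : Fin n → ℝ}
    {u : Fin n → GridState n m → (Fin n → ℝ) → ℝ}
    (hu : ∀ i ∈ N.controlled, LocallyLipschitz fun x => u i x p) :
    LocallyLipschitz (N.field p u) := by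
  refine LocallyLipschitz.prodMk (f := fun x : GridState n m => N.incidence *ᵥ x.2) ?_ ?_
  · refine ContDiff.locallyLipschitz (𝕂 := ℝ) ?_
    exact contDiff_pi.2 fun k => by
      simp only [incidence_mulVec_apply]
      fun_prop
  · refine LocallyLipschitz.pi fun i => ?_
    have hsm : LocallyLipschitz fun x : GridState n m =>
        (-(N.damping i * x.2 i) - N.flow x.1 i + p i) / N.inertia i := by
      refine ContDiff.locallyLipschitz (𝕂 := ℝ) ?_
      simp only [flow, Matrix.mulVec, dotProduct, sinVec]
      fun_prop
    have hctl : LocallyLipschitz fun x : GridState n m =>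
        (if i ∈ N.controlled then u i x p else 0) / N.inertia i := by
      split_ifs with hi
      · have hdiv : LocallyLipschitz fun s : ℝ => s / N.inertia i :=
          ContDiff.locallyLipschitz (𝕂 := ℝ) (by fun_prop)
        exact hdiv.comp (hu i hi)
      · simpa using LocallyLipschitz.const (0 : ℝ)
    have h : LocallyLipschitz fun x : GridState n m =>
        (-(N.damping i * x.2 i) - N.flow x.1 i + p i) / N.inertia i
          + (if i ∈ N.controlled then u i x p else 0) / N.inertia i := hsm.add hctl
    convert h using 2 with x
    ring

end PowerNetwork

theorem MapClusterPt.eq_of_tendsto {X Y ι : Type*} [TopologicalSpace X] [TopologicalSpace Y]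
    [T2Space Y] {l : Filter ι} {f : ι → X} {h : X → Y} {x : X} {y : Y}
    (hx : MapClusterPt x l f) (hc : Continuous h) (hy : Tendsto (fun t => h (f t)) l (𝓝 y)) :
    h x = y := by
  have h1 : MapClusterPt (h x) l (h ∘ f) := hx.continuousAt_comp hc.continuousAt
  have h2 : NeBot (𝓝 (h x) ⊓ 𝓝 y) := NeBot.mono h1 (inf_le_inf_left _ hy)
  exact eq_of_nhds_neBot h2

/-! ### Compact trapping regions and the solutions in them. -/

namespace PowerNetwork

variable {n m : ℕ}

/-- `{(λ, ω) : λ ∈ Γ_cl, V(λ, ω) ≤ d}`. -/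
def sublevel (N : PowerNetwork n m) (p : Fin n → ℝ) (lInf : Fin m → ℝ) (d : ℝ) :
    Set (GridState n m) :=
  {x | x.1 ∈ closedBox m ∧ N.energy p lInf x ≤ d}

theorem potential_nonneg (N : PowerNetwork n m) {lInf l : Fin m → ℝ} (hlInf : lInf ∈ openBox m)
    (hl : l ∈ closedBox m) : 0 ≤ ∑ k, N.susceptance k * lineEnergy (lInf k) (l k) :=
  Finset.sum_nonneg fun k _ => mul_nonneg (N.susceptance_pos k).le
    (lineEnergy_nonneg (hlInf k) (hl k))

theorem kinetic_term_nonneg (N : PowerNetwork n m) (ω : Fin n → ℝ) (a : ℝ) (i : Fin n) :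
    0 ≤ N.inertia i * (ω i - a) ^ 2 :=
  mul_nonneg (N.inertia_pos i).le (sq_nonneg _)

theorem energy_nonneg (N : PowerNetwork n m) (p : Fin n → ℝ) {lInf : Fin m → ℝ}
    (hlInf : lInf ∈ openBox m) {x : GridState n m} (hx : x.1 ∈ closedBox m) :
    0 ≤ N.energy p lInf x :=
  add_nonneg (mul_nonneg (by norm_num)
    (Finset.sum_nonneg fun i _ => N.kinetic_term_nonneg x.2 _ i)) (N.potential_nonneg hlInf hx)

theorem energy_equilibrium (N : PowerNetwork n m) (p : Fin n → ℝ) (lInf : Fin m → ℝ) :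
    N.energy p lInf (lInf, N.omegaInfVec p) = 0 := by
  simp [energy, omegaInfVec, lineEnergy_self]

theorem energy_pos (N : PowerNetwork n m) (p : Fin n → ℝ) {lInf : Fin m → ℝ}
    (hlInf : lInf ∈ openBox m) {x : GridState n m} (hx : x.1 ∈ closedBox m)
    (hne : x ≠ (lInf, N.omegaInfVec p)) : 0 < N.energy p lInf x := by
  refine (N.energy_nonneg p hlInf hx).lt_of_ne fun h0 => hne ?_
  have hk := Finset.sum_nonneg fun i (_ : i ∈ Finset.univ) =>
    N.kinetic_term_nonneg x.2 (N.omegaInf p) i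
  have hp := N.potential_nonneg hlInf hx
  unfold energy at h0
  have hk0 : ∑ i, N.inertia i * (x.2 i - N.omegaInf p) ^ 2 = 0 := by linarith
  have hp0 : ∑ k, N.susceptance k * lineEnergy (lInf k) (x.1 k) = 0 := by linarith
  refine Prod.ext (funext fun k => ?_) (funext fun i => ?_)
  · have := (Finset.sum_eq_zero_iff_of_nonneg fun k _ => mul_nonneg (N.susceptance_pos k).le
      (lineEnergy_nonneg (hlInf k) (hx k))).1 hp0 k (Finset.mem_univ k)
    by_contra hne'
    exact (mul_pos (N.susceptance_pos k) (lineEnergy_pos (hlInf k) (hx k) hne')).ne' this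
  · have := (Finset.sum_eq_zero_iff_of_nonneg fun i _ =>
      N.kinetic_term_nonneg x.2 (N.omegaInf p) i).1 hk0 i (Finset.mem_univ i)
    exact sub_eq_zero.1 (pow_eq_zero_iff two_ne_zero |>.1
      ((mul_eq_zero.1 this).resolve_left (N.inertia_pos i).ne'))

theorem isClosed_sublevel (N : PowerNetwork n m) (p : Fin n → ℝ) (lInf : Fin m → ℝ) (d : ℝ) :
    IsClosed (N.sublevel p lInf d) :=
  ((isClosed_closedBox m).preimage continuous_fst).inter
    (isClosed_le (N.continuous_energy p lInf) continuous_const)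

theorem isCompact_sublevel (N : PowerNetwork n m) (p : Fin n → ℝ) {lInf : Fin m → ℝ}
    (hlInf : lInf ∈ openBox m) (d : ℝ) : IsCompact (N.sublevel p lInf d) := by
  have hbox : IsCompact (closedBox m) := by
    rw [closedBox_eq_pi]
    exact isCompact_univ_pi fun _ => isCompact_Icc
  refine (hbox.prod (isCompact_univ_pi fun i => isCompact_Icc
    (a := N.omegaInf p - √(2 * d / N.inertia i))
    (b := N.omegaInf p + √(2 * d / N.inertia i)))).of_isClosed_subset
    (N.isClosed_sublevel p lInf d) ?_
  rintro x ⟨hx, hV⟩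
  refine ⟨hx, fun i _ => ?_⟩
  have hp := N.potential_nonneg hlInf hx
  have hk := Finset.single_le_sum (fun i _ => N.kinetic_term_nonneg x.2 (N.omegaInf p) i)
    (Finset.mem_univ i)
  unfold energy at hV
  -- The potential and the other kinetic terms are nonnegative, so `d` bounds each kinetic term
  -- alone.
  have h : |x.2 i - N.omegaInf p| ≤ √(2 * d / N.inertia i) := by
    refine Real.abs_le_sqrt ?_
    rw [le_div_iff₀ (N.inertia_pos i)]
    linarith
  rw [abs_le] at h
  exact ⟨by linarith, by linarith⟩

theorem energyLevel_pos (N : PowerNetwork n m) (hm : 1 ≤ m) (p : Fin n → ℝ) {lInf : Fin m → ℝ}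
    (hlInf : lInf ∈ openBox m) : 0 < N.energyLevel p lInf := by
  obtain ⟨l, hl, hc⟩ := (N.isLeast_energyLevel hm p lInf).1
  rw [← hc]
  refine N.energy_pos p hlInf ((isClosed_closedBox m).frontier_subset hl) fun h => ?_
  have hl' : l = lInf := congrArg Prod.fst h
  rw [(isClosed_closedBox m).frontier_eq, hl'] at hl
  exact hl.2 (openBox_subset_interior_closedBox m hlInf)

/-- Removing the kinetic energy only lowers `V`, so a state with boundary angles has energy at least
`c`. -/
theorem fst_mem_interior_of_mem_sublevel (N : PowerNetwork n m) (hm : 1 ≤ m) {p : Fin n → ℝ}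
    {lInf : Fin m → ℝ} {d : ℝ} (hd : d < N.energyLevel p lInf) {x : GridState n m}
    (hx : x ∈ N.sublevel p lInf d) : x.1 ∈ interior (closedBox m) := by
  by_contra hni
  have hfr : x.1 ∈ frontier (closedBox m) := by
    rw [(isClosed_closedBox m).frontier_eq]
    exact ⟨hx.1, hni⟩
  have h1 : N.energyLevel p lInf ≤ N.energy p lInf (x.1, N.omegaInfVec p) :=
    (N.isLeast_energyLevel hm p lInf).2 ⟨x.1, hfr, rfl⟩
  have h2 : N.energy p lInf (x.1, N.omegaInfVec p) ≤ N.energy p lInf x := by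
    have hk := Finset.sum_nonneg fun i (_ : i ∈ Finset.univ) =>
      N.kinetic_term_nonneg x.2 (N.omegaInf p) i
    simp only [energy, omegaInfVec, sub_self]
    simp only [ne_eq, OfNat.ofNat_ne_zero, not_false_eq_true, zero_pow, mul_zero,
      Finset.sum_const_zero]
    linarith
  linarith [hx.2]

/-- Allowing a field `G` that agrees with the closed loop only on `O` covers the truncated system as
well as, with `O = univ`, the true one. -/
theorem mem_sublevel_of_solution (N : PowerNetwork n m) (hm : 1 ≤ m) {p : Fin n → ℝ}
    {lInf : Fin m → ℝ} (hlInf_eq : N.pTilde p = N.flow lInf)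
    {u : Fin n → GridState n m → (Fin n → ℝ) → ℝ}
    (hu_sign : ∀ i ∈ N.controlled, ∀ x : GridState n m,
      x.2 i ≠ N.omegaInf p → (x.2 i - N.omegaInf p) * u i x p ≤ 0)
    {d : ℝ} (hd : d < N.energyLevel p lInf) {G : GridState n m → GridState n m}
    {O : Set (GridState n m)} (hO : IsOpen O) (hKO : N.sublevel p lInf d ⊆ O)
    (hG : EqOn G (N.field p u) O) {y : ℝ → GridState n m} {T : ℝ}
    (hy : IsSolutionOn G y (Icc 0 T)) (h0 : y 0 ∈ N.sublevel p lInf d) :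
    ∀ t ∈ Icc 0 T, y t ∈ N.sublevel p lInf d := by
  refine mem_of_nonincreasing_along (V := N.energy p lInf) (V' := N.dissipation p u)
    (O := O ∩ Prod.fst ⁻¹' interior (closedBox m)) (N.isClosed_sublevel p lInf d)
    (hO.inter (isOpen_interior.preimage continuous_fst))
    (fun x hx => ⟨hKO hx, N.fst_mem_interior_of_mem_sublevel hm hd hx⟩)
    (fun x _ => N.dissipation_nonpos hu_sign x)
    (fun x hx z hz hzx => ⟨interior_subset hz.2, hzx.trans hx.2⟩)
    (fun t ht => (hy t ht).continuousWithinAt) (fun t ht htO => ?_) h0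
  have := hy t ht
  rw [hG htO.1] at this
  exact N.hasDerivWithinAt_energy_field hlInf_eq u this

/-- The truncated field has a global solution; trapping keeps it in the ball where truncation
changes nothing. -/
theorem exists_solution_mem_sublevel (N : PowerNetwork n m) (hm : 1 ≤ m) {p : Fin n → ℝ}
    {lInf : Fin m → ℝ} (hlInf : lInf ∈ openBox m) (hlInf_eq : N.pTilde p = N.flow lInf)
    {u : Fin n → GridState n m → (Fin n → ℝ) → ℝ}
    (hu_lip : ∀ i ∈ N.controlled, LocallyLipschitz fun x => u i x p)
    (hu_sign : ∀ i ∈ N.controlled, ∀ x : GridState n m,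
      x.2 i ≠ N.omegaInf p → (x.2 i - N.omegaInf p) * u i x p ≤ 0)
    {d : ℝ} (hd : d < N.energyLevel p lInf) {x₀ : GridState n m}
    (h0 : x₀ ∈ N.sublevel p lInf d) :
    ∃ x : ℝ → GridState n m, IsSolutionOn (N.field p u) x (Ici 0) ∧ x 0 = x₀ ∧
      ∀ t, 0 ≤ t → x t ∈ N.sublevel p lInf d := by
  obtain ⟨R, hR0, hR⟩ := (N.isCompact_sublevel p hlInf d).isBounded.subset_ball_lt 0 0
  have hball : IsCompact (Metric.closedBall (0 : GridState n m) R) := isCompact_closedBall 0 R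
  obtain ⟨K, hK⟩ := LocallyLipschitzOn.exists_lipschitzOnWith_of_compact hball
    (N.locallyLipschitz_field hu_lip).locallyLipschitzOn
  have hmaps : ∀ x, clampState R x ∈ Metric.closedBall (0 : GridState n m) R :=
    clampState_mem_closedBall hR0.le
  have hlip : LipschitzWith (K * 1) (N.field p u ∘ clampState R) := by
    rw [← lipschitzOnWith_univ]
    exact hK.comp (lipschitzWith_clampState R).lipschitzOnWith fun x _ => hmaps x
  obtain ⟨C, hC⟩ := hball.exists_bound_of_continuousOn hK.continuousOn
  obtain ⟨x, hx0, hx⟩ := exists_solution_Ici_of_lipschitz_of_bounded hlip (L := C.toNNReal)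
    (fun x => (hC _ (hmaps x)).trans (Real.le_coe_toNNReal C)) x₀
  have heq : EqOn (N.field p u ∘ clampState R) (N.field p u) (Metric.ball 0 R) := fun z hz => by
    rw [Function.comp_apply, clampState_eq_self (Metric.ball_subset_closedBall hz)]
  have hmem : ∀ t, 0 ≤ t → x t ∈ N.sublevel p lInf d := fun t ht =>
    N.mem_sublevel_of_solution hm hlInf_eq hu_sign hd Metric.isOpen_ball hR heq
      (fun s hs => (hx s hs.1).mono Icc_subset_Ici_self) (hx0 ▸ h0) t ⟨ht, le_rfl⟩
  refine ⟨x, fun t ht => ?_, hx0, hmem⟩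
  have := hx t ht
  rwa [heq (hR (hmem t ht))] at this

theorem eqOn_of_solutions (N : PowerNetwork n m) (hm : 1 ≤ m) {p : Fin n → ℝ}
    {lInf : Fin m → ℝ} (hlInf : lInf ∈ openBox m) (hlInf_eq : N.pTilde p = N.flow lInf)
    {u : Fin n → GridState n m → (Fin n → ℝ) → ℝ}
    (hu_lip : ∀ i ∈ N.controlled, LocallyLipschitz fun x => u i x p)
    (hu_sign : ∀ i ∈ N.controlled, ∀ x : GridState n m,
      x.2 i ≠ N.omegaInf p → (x.2 i - N.omegaInf p) * u i x p ≤ 0)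
    {d : ℝ} (hd : d < N.energyLevel p lInf) {x y : ℝ → GridState n m}
    (h0 : x 0 ∈ N.sublevel p lInf d) (hxy : y 0 = x 0) {T : ℝ}
    (hx : IsSolutionOn (N.field p u) x (Ici 0)) (hy : IsSolutionOn (N.field p u) y (Ico 0 T)) :
    EqOn y x (Ico 0 T) := by
  intro t ht
  obtain ⟨K, hK⟩ := LocallyLipschitzOn.exists_lipschitzOnWith_of_compact
    (N.isCompact_sublevel p hlInf d) (N.locallyLipschitz_field hu_lip).locallyLipschitzOn
  have hx' : IsSolutionOn (N.field p u) x (Icc 0 t) := fun s hs =>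
    (hx s hs.1).mono Icc_subset_Ici_self
  have hy' : IsSolutionOn (N.field p u) y (Icc 0 t) := fun s hs =>
    (hy s ⟨hs.1, hs.2.trans_lt ht.2⟩).mono fun r hr => ⟨hr.1, hr.2.trans_lt ht.2⟩
  exact eqOn_Icc_of_lipschitzOn hK hy' hx'
    (N.mem_sublevel_of_solution hm hlInf_eq hu_sign hd isOpen_univ (subset_univ _)
      (fun _ _ => rfl) hy' (hxy ▸ h0))
    (N.mem_sublevel_of_solution hm hlInf_eq hu_sign hd isOpen_univ (subset_univ _)
      (fun _ _ => rfl) hx' h0) hxy ⟨ht.1, le_rfl⟩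

/-! ### Invariance of the range of `D`, and convergence. -/

theorem rangeD_eq (N : PowerNetwork n m) :
    N.rangeD = (LinearMap.range N.incidence.mulVecLin : Set (Fin m → ℝ)) := rfl

theorem isClosed_rangeD (N : PowerNetwork n m) : IsClosed N.rangeD := by
  rw [rangeD_eq]
  exact Submodule.closed_of_finiteDimensional _

/-- A linear functional vanishing on `range D` is constant along `λ`, because `λ' = D ω`; such
functionals separate points from the range. -/
theorem fst_mem_rangeD_of_solution (N : PowerNetwork n m) {p : Fin n → ℝ}
    {u : Fin n → GridState n m → (Fin n → ℝ) → ℝ} {x : ℝ → GridState n m}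
    (hx : IsSolutionOn (N.field p u) x (Ici 0)) (h0 : (x 0).1 ∈ N.rangeD) {t : ℝ} (ht : 0 ≤ t) :
    (x t).1 ∈ N.rangeD := by
  by_contra hnot
  rw [rangeD_eq] at h0 hnot
  obtain ⟨f, hf, hker⟩ := Submodule.exists_le_ker_of_notMem hnot
  have hd : ∀ s ∈ Ici (0 : ℝ), HasDerivWithinAt (fun r => f (x r).1) 0 (Ici 0) s := fun s hs => by
    have h1 := f.toContinuousLinearMap.hasFDerivAt.comp_hasDerivWithinAt s (hx s hs).fst
    refine h1.congr_deriv ?_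
    exact hker ⟨(x s).2, rfl⟩
  refine hf ?_
  rw [constant_of_has_deriv_right_zero (f := fun r => f (x r).1) (a := 0) (b := t)
    (fun s hs => (hd s hs.1).continuousWithinAt.mono Icc_subset_Ici_self)
    (fun s hs => (hd s hs.1).mono (Ici_subset_Ici.2 hs.1)) t ⟨ht, le_rfl⟩]
  exact hker h0

theorem field_equilibrium (N : PowerNetwork n m) {p : Fin n → ℝ} {lInf : Fin m → ℝ}
    (hlInf_eq : N.pTilde p = N.flow lInf) {u : Fin n → GridState n m → (Fin n → ℝ) → ℝ}
    (hu_zero : ∀ i ∈ N.controlled, ∀ x : GridState n m, x.2 i = N.omegaInf p → u i x p = 0) :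
    N.field p u (lInf, N.omegaInfVec p) = 0 := by
  refine Prod.ext (N.incidence_mulVec_const _) (funext fun i => ?_)
  have hu : (if i ∈ N.controlled then u i (lInf, N.omegaInfVec p) p else 0) = 0 := by
    split_ifs with hi
    · exact hu_zero i hi _ rfl
    · rfl
  simp only [field]
  rw [hu, ← congrFun hlInf_eq i]
  simp only [pTilde, omegaInfVec, Prod.snd_zero, Pi.zero_apply, div_eq_zero_iff]
  left
  ring

theorem tendsto_equilibrium (N : PowerNetwork n m) {p : Fin n → ℝ} {lInf : Fin m → ℝ}
    (hlInf : lInf ∈ openBox m) (hlInf_range : lInf ∈ N.rangeD)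
    (hlInf_eq : N.pTilde p = N.flow lInf) {u : Fin n → GridState n m → (Fin n → ℝ) → ℝ}
    (hu_lip : ∀ i ∈ N.controlled, LocallyLipschitz fun x => u i x p)
    (hu_sign : ∀ i ∈ N.controlled, ∀ x : GridState n m,
      x.2 i ≠ N.omegaInf p → (x.2 i - N.omegaInf p) * u i x p ≤ 0)
    (hu_zero : ∀ i ∈ N.controlled, ∀ x : GridState n m, x.2 i = N.omegaInf p → u i x p = 0)
    {d : ℝ} {x : ℝ → GridState n m} (hx : IsSolutionOn (N.field p u) x (Ici 0))
    (hmem : ∀ t, 0 ≤ t → x t ∈ N.sublevel p lInf d) (hrange : (x 0).1 ∈ N.rangeD) :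
    Tendsto x atTop (𝓝 (lInf, N.omegaInfVec p)) := by
  have hK := N.isCompact_sublevel p hlInf d
  have hF : Continuous (N.field p u) := (N.locallyLipschitz_field hu_lip).continuous
  -- Compactness bounds the velocity, so `x` is Lipschitz and continuous functions of it meet
  -- Barbalat's hypothesis.
  have hxuc : UniformContinuousOn x (Ici 0) := by
    obtain ⟨C, hC⟩ := hK.exists_bound_of_continuousOn hF.continuousOn
    refine (Convex.lipschitzOnWith_of_nnnorm_hasDerivWithin_le (convex_Ici 0)
      (C := C.toNNReal) hx fun t ht => ?_).uniformContinuousOn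
    exact NNReal.coe_le_coe.1 ((hC _ (hmem t ht)).trans (Real.le_coe_toNNReal C))
  have huc : ∀ {h : GridState n m → ℝ}, Continuous h →
      UniformContinuousOn (fun t => h (x t)) (Ici 0) := fun hh =>
    (hK.uniformContinuousOn_of_continuous hh.continuousOn).comp hxuc fun t ht => hmem t ht
  have hdE : ∀ t ∈ Ici (0 : ℝ), HasDerivWithinAt (fun r => N.energy p lInf (x r))
      (N.dissipation p u (x t)) (Ici 0) t := fun t ht =>
    N.hasDerivWithinAt_energy_field hlInf_eq u (hx t ht)
  obtain ⟨a, ha⟩ : ∃ a, Tendsto (fun t => N.energy p lInf (x t)) atTop (𝓝 a) := by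
    have hanti : AntitoneOn (fun t => N.energy p lInf (x t)) (Ici 0) :=
      antitoneOn_of_hasDerivWithinAt_nonpos (convex_Ici 0)
        (fun t ht => (hdE t ht).continuousWithinAt)
        (fun t ht => (hdE t (interior_subset ht)).mono interior_subset)
        (fun t _ => N.dissipation_nonpos hu_sign (x t))
    -- Nothing is known at negative times; freezing them at 0 gives a globally antitone function.
    have hanti' : Antitone fun t => N.energy p lInf (x (max t 0)) := fun s t hst =>
      hanti (le_max_right s 0) (le_max_right t 0) (max_le_max_right 0 hst)
    have hbdd : BddBelow (range fun t => N.energy p lInf (x (max t 0))) := by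
      refine ⟨0, ?_⟩
      rintro _ ⟨t, rfl⟩
      exact N.energy_nonneg p hlInf (hmem _ (le_max_right t 0)).1
    refine ⟨_, (tendsto_atTop_ciInf hanti' hbdd).congr' ?_⟩
    filter_upwards [eventually_ge_atTop 0] with t ht
    rw [max_eq_left ht]
  have hdiss : Tendsto (fun t => N.dissipation p u (x t)) atTop (𝓝 0) :=
    tendsto_deriv_zero_of_uniformContinuousOn hdE
      (huc (N.continuous_dissipation fun i hi => (hu_lip i hi).continuous)) ha
  have hω : ∀ i, Tendsto (fun t => (x t).2 i) atTop (𝓝 (N.omegaInf p)) := by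
    intro i
    have hsq : Tendsto (fun t => ((x t).2 i - N.omegaInf p) ^ 2) atTop (𝓝 0) := by
      refine squeeze_zero (g := fun t => -N.dissipation p u (x t) / N.damping i)
        (fun t => sq_nonneg _) (fun t => ?_) ?_
      · rw [le_div_iff₀ (N.damping_pos i), mul_comm]
        exact N.damping_mul_sq_le_neg_dissipation hu_sign (x t) i
      · simpa using hdiss.neg.div_const (N.damping i)
    have habs : Tendsto (fun t => |(x t).2 i - N.omegaInf p|) atTop (𝓝 0) := by
      simpa [Real.sqrt_sq_eq_abs] using hsq.sqrt
    simpa using ((tendsto_zero_iff_abs_tendsto_zero _).2 habs).add_const (N.omegaInf p)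
  -- Second use of Barbalat, now on the convergent frequencies.
  have hacc : ∀ i, Tendsto (fun t => (N.field p u (x t)).2 i) atTop (𝓝 0) := fun i =>
    tendsto_deriv_zero_of_uniformContinuousOn
      (fun t ht => hasDerivWithinAt_pi.1 (hx t ht).snd i)
      (huc ((continuous_apply i).comp (continuous_snd.comp hF))) (hω i)
  have hKr : IsCompact (N.sublevel p lInf d ∩ Prod.fst ⁻¹' N.rangeD) :=
    hK.inter_right (N.isClosed_rangeD.preimage continuous_fst)
  refine hKr.tendsto_nhds_of_unique_mapClusterPt ?_ fun z hz hcl => ?_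
  · filter_upwards [eventually_ge_atTop 0] with t ht
    exact ⟨hmem t ht, N.fst_mem_rangeD_of_solution hx hrange ht⟩
  · have hz2 : ∀ i, z.2 i = N.omegaInf p := fun i =>
      hcl.eq_of_tendsto ((continuous_apply i).comp continuous_snd) (hω i)
    have hzF : ∀ i, (N.field p u z).2 i = 0 := fun i =>
      hcl.eq_of_tendsto ((continuous_apply i).comp (continuous_snd.comp hF)) (hacc i)
    refine Prod.ext (N.eq_of_flow_eq hz.1.1 (fun k => (hlInf k).le) hz.2 hlInf_range ?_)
      (funext hz2)
    rw [← hlInf_eq]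
    funext i
    have hu : (if i ∈ N.controlled then u i z p else 0) = 0 := by
      split_ifs with hi
      · exact hu_zero i hi _ (hz2 i)
      · rfl
    have h := (div_eq_zero_iff.1 (hzF i)).resolve_right (N.inertia_pos i).ne'
    rw [hu, hz2 i] at h
    rw [pTilde]
    linarith

/-! ### Lyapunov stability and the main theorem. -/

/-- On the compact part of a sublevel set outside `interior U`, `V` has a positive minimum; any
positive level below it excludes that part. -/
theorem exists_sublevel_subset (N : PowerNetwork n m) (p : Fin n → ℝ) {lInf : Fin m → ℝ}
    (hlInf : lInf ∈ openBox m) {c : ℝ} (hc : 0 < c) {U : Set (GridState n m)}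
    (hU : U ∈ 𝓝 (lInf, N.omegaInfVec p)) :
    ∃ d, 0 < d ∧ d < c ∧ N.sublevel p lInf d ⊆ U := by
  have hcomp : IsCompact (N.sublevel p lInf (c / 2) \ interior U) :=
    (N.isCompact_sublevel p hlInf (c / 2)).diff isOpen_interior
  rcases (N.sublevel p lInf (c / 2) \ interior U).eq_empty_or_nonempty with he | hne
  · exact ⟨c / 2, by positivity, by linarith, (sdiff_eq_empty.1 he).trans interior_subset⟩
  · obtain ⟨z, hz, hmin⟩ := hcomp.exists_isMinOn hne (N.continuous_energy p lInf).continuousOn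
    have hzpos : 0 < N.energy p lInf z := N.energy_pos p hlInf hz.1.1 fun h =>
      hz.2 (h ▸ mem_interior_iff_mem_nhds.2 hU)
    refine ⟨min (c / 2) (N.energy p lInf z / 2), by positivity,
      (min_le_left _ _).trans_lt (by linarith), fun x hx => ?_⟩
    by_contra hxU
    have h1 : N.energy p lInf z ≤ N.energy p lInf x :=
      hmin ⟨⟨hx.1, hx.2.trans (min_le_left _ _)⟩, fun h => hxU (interior_subset h)⟩
    linarith [hx.2.trans (min_le_right _ _)]

theorem isStableEquilibrium (N : PowerNetwork n m) (hm : 1 ≤ m) {p : Fin n → ℝ}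
    {lInf : Fin m → ℝ} (hlInf : lInf ∈ openBox m) (hlInf_eq : N.pTilde p = N.flow lInf)
    {u : Fin n → GridState n m → (Fin n → ℝ) → ℝ}
    (hu_lip : ∀ i ∈ N.controlled, LocallyLipschitz fun x => u i x p)
    (hu_sign : ∀ i ∈ N.controlled, ∀ x : GridState n m,
      x.2 i ≠ N.omegaInf p → (x.2 i - N.omegaInf p) * u i x p ≤ 0)
    (hu_zero : ∀ i ∈ N.controlled, ∀ x : GridState n m, x.2 i = N.omegaInf p → u i x p = 0) :
    IsStableEquilibrium (N.field p u) (lInf, N.omegaInfVec p) := by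
  refine ⟨N.field_equilibrium hlInf_eq hu_zero, fun U hU => ?_⟩
  obtain ⟨d, hd0, hdc, hdU⟩ :=
    N.exists_sublevel_subset p hlInf (N.energyLevel_pos hm p hlInf) hU
  refine ⟨Prod.fst ⁻¹' interior (closedBox m) ∩ {x | N.energy p lInf x < d}, ?_, ?_⟩
  · refine ((isOpen_interior.preimage continuous_fst).inter
      (isOpen_lt (N.continuous_energy p lInf) continuous_const)).mem_nhds
      ⟨openBox_subset_interior_closedBox m hlInf, ?_⟩
    rw [mem_ofPred_eq, energy_equilibrium]
    exact hd0
  · rintro x₀ ⟨hx₀, hE⟩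
    have h0 : x₀ ∈ N.sublevel p lInf d := ⟨interior_subset hx₀, le_of_lt hE⟩
    refine ⟨?_, fun x hx hx0 t ht => hdU ?_⟩
    · obtain ⟨x, hx, hx0, -⟩ :=
        N.exists_solution_mem_sublevel hm hlInf hlInf_eq hu_lip hu_sign hdc h0
      exact ⟨x, hx, hx0⟩
    · exact N.mem_sublevel_of_solution hm hlInf_eq hu_sign hdc isOpen_univ (subset_univ _)
        (fun _ _ => rfl) (fun s hs => (hx s hs.1).mono Icc_subset_Ici_self) (hx0 ▸ h0) t
        ⟨ht, le_rfl⟩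

end PowerNetwork

theorem mainTheorem2 {n m : ℕ} (N : PowerNetwork n m) (hm : 1 ≤ m)
    (p : Fin n → ℝ)
    (lInf : Fin m → ℝ) (hlInf : lInf ∈ openBox m) (hlInf_range : lInf ∈ N.rangeD)
    (hlInf_eq : N.pTilde p = N.flow lInf)
    (u : Fin n → GridState n m → (Fin n → ℝ) → ℝ)
    (hu_lip : ∀ i ∈ N.controlled, LocallyLipschitz fun x => u i x p)
    (hu_sign : ∀ i ∈ N.controlled, ∀ x : GridState n m,
      x.2 i ≠ N.omegaInf p → (x.2 i - N.omegaInf p) * u i x p ≤ 0)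
    (hu_zero : ∀ i ∈ N.controlled, ∀ x : GridState n m,
      x.2 i = N.omegaInf p → u i x p = 0) :
    (∀ l ∈ closedBox m, l ∈ N.rangeD → N.pTilde p = N.flow l → l = lInf) ∧
    IsStableEquilibrium (N.field p u) (lInf, N.omegaInfVec p) ∧
    ∀ β : ℝ, 1 < β → ∀ x₀ : GridState n m, x₀.1 ∈ N.rangeD → x₀ ∈ N.region p lInf β →
      ∃ x : ℝ → GridState n m,
        IsSolutionOn (N.field p u) x (Ici 0) ∧ x 0 = x₀ ∧
        (∀ (T : ℝ) (y : ℝ → GridState n m),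
          IsSolutionOn (N.field p u) y (Ico 0 T) → y 0 = x₀ → EqOn y x (Ico 0 T)) ∧
        (∀ t, 0 ≤ t → (x t).1 ∈ N.rangeD ∧ x t ∈ N.region p lInf β) ∧
        Tendsto x atTop (𝓝 (lInf, N.omegaInfVec p)) := by
  refine ⟨fun l hl hr h => N.eq_of_flow_eq hl (fun k => (hlInf k).le) hr hlInf_range
      (h.symm.trans hlInf_eq),
    N.isStableEquilibrium hm hlInf hlInf_eq hu_lip hu_sign hu_zero, fun β hβ x₀ hr h0 => ?_⟩
  have hd : N.energyLevel p lInf / β < N.energyLevel p lInf :=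
    div_lt_self (N.energyLevel_pos hm p hlInf) hβ
  -- `N.region p lInf β` is by definition the sublevel set at `c / β`, so `h0` and `hmem` need no
  -- conversion.
  obtain ⟨x, hx, hx0, hmem⟩ :=
    N.exists_solution_mem_sublevel hm hlInf hlInf_eq hu_lip hu_sign hd h0
  subst hx0
  exact ⟨x, hx, rfl,
    fun T y hy hy0 => N.eqOn_of_solutions hm hlInf hlInf_eq hu_lip hu_sign hd h0 hy0 hx hy,
    fun t ht => ⟨N.fst_mem_rangeD_of_solution hx hr ht, hmem t ht⟩,
    N.tendsto_equilibrium hlInf hlInf_range hlInf_eq hu_lip hu_sign hu_zero hx hmem hr⟩
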